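/- A binary data element (BDE) is a pair $(X,Y)$ of random variables on a common probability space, where $X$ takes values in $\{0,1\}$ and $Y$ takes values in an arbitrary measurable space. Its varentropy is $$V(X|Y)=\operatorname{Var}\bigl(h(X|Y)\bigr),\qquad h(X|Y)=-\log_2 p_{X|Y}(X|Y),$$ where $p_{X|Y}$ denotes the conditional distribution of $X$ given $Y$. Let $N=2^n$ for some $n\ge 1$, and let $(X_i,Y_i)$, $1\le i\le N$, be independent, but not necessarily identically distributed, BDEs, where $Y_i$ takes values in an arbitrary measurable space $\mathcal Y_i$. Let $$\mathbf U=(U_1,\dots,U_N)=(X_1,\dots,X_N)\,F^{\otimes n},\qquad F=\begin{bmatrix}1&0\\1&1\end{bmatrix},$$ computed modulo $2$, where $F^{\otimes n}$ is the $n$-th Kronecker power of $F$. Write $\mathbf Y=(Y_1,\dots,Y_N)$ and $\mathbf U^{i-1}=(U_1,\dots,U_{i-1})$. Then all the random variables $h(X_i|Y_i)$ and $h(U_i|\mathbf U^{i-1},\mathbf Y)$ are square-integrable, and $$\sum_{i=1}^N V(U_i|\mathbf U^{i-1},\mathbf Y)\le\sum_{i=1}^N V(X_i|Y_i).$$ 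-/

import Mathlib

open MeasureTheory ProbabilityTheory

noncomputable section

/-- The conditional entropy random variable `h(X|Y) = -log₂ p_{X|Y}(X|Y)` of a binary data element
`(X, Y)`, where `p_{X|Y}(·|y)` is the regular conditional distribution of `X` given `Y = y`.
The alphabet `S` of the side information `Y` is an arbitrary measurable space. -/
def condEntropyRV {Ω S : Type*} [MeasurableSpace Ω] [MeasurableSpace S]
    (μ : Measure Ω) [IsFiniteMeasure μ] (X : Ω → ZMod 2) (Y : Ω → S) : Ω → ℝ :=
  fun ω => -Real.logb 2 ((condDistrib X Y μ (Y ω)).real {X ω})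

/-- The varentropy `V(X|Y) = Var(h(X|Y))`. -/
def varentropy {Ω S : Type*} [MeasurableSpace Ω] [MeasurableSpace S]
    (μ : Measure Ω) [IsFiniteMeasure μ] (X : Ω → ZMod 2) (Y : Ω → S) : ℝ :=
  variance (condEntropyRV μ X Y) μ

end

/-- The identification of `Fin m × Fin (m ^ n)` with `Fin (m ^ (n + 1))` in lexicographic order,
`(a, b) ↦ a * m ^ n + b`. -/
def kroneckerIndexEquiv (m n : ℕ) : Fin m × Fin (m ^ n) ≃ Fin (m ^ (n + 1)) :=
  finProdFinEquiv.trans (finCongr (pow_succ' m n).symm)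

/-- The `n`-th Kronecker power `A ⊗ ⋯ ⊗ A` of a square matrix. -/
def kroneckerPow {R : Type*} [CommSemiring R] {m : ℕ} (A : Matrix (Fin m) (Fin m) R) :
    (n : ℕ) → Matrix (Fin (m ^ n)) (Fin (m ^ n)) R
  | 0 => 1
  | n + 1 => Matrix.reindex (kroneckerIndexEquiv m n) (kroneckerIndexEquiv m n)
      (Matrix.kronecker A (kroneckerPow A n))

/-- The kernel `F = [1 0; 1 1]` over the two-element field. -/
def polarKernel : Matrix (Fin 2) (Fin 2) (ZMod 2) := !![1, 0; 1, 1]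

/-- The polar transform `U = X G_N`, with `N = 2 ^ n` and `G_N` the `n`-th Kronecker power of `F`,
applied pointwise to a random row vector `X = (X_1, …, X_N)`. -/
def polarTransform {Ω : Type*} (n : ℕ) (X : Fin (2 ^ n) → Ω → ZMod 2) :
    Fin (2 ^ n) → Ω → ZMod 2 :=
  fun i ω => Matrix.vecMul (fun j => X j ω) (kroneckerPow polarKernel n) i

/-- The side information `(U^{i-1}, Y)` of the `i`-th output of the polar transform: all the `U_j`
with `j < i`, together with the whole vector `Y = (Y_1, …, Y_N)`. -/
def polarSideInfo {Ω : Type*} {n : ℕ} {S : Fin (2 ^ n) → Type*} (X : Fin (2 ^ n) → Ω → ZMod 2)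
    (Y : (i : Fin (2 ^ n)) → Ω → S i) (i : Fin (2 ^ n)) :
    Ω → (Set.Iio i → ZMod 2) × ((j : Fin (2 ^ n)) → S j) :=
  fun ω => (fun j => polarTransform n X j ω, fun j => Y j ω)

/-! The core is the case of two inputs, with outputs `U₁ = X₁ + X₂` and `U₂ = X₂`. Let `A` and `B`
be the surprisals of `U₁` given `Y`, and of `U₂` given `(U₁, Y)`. The map from inputs to outputs is
a bijection, so `A + B` is almost surely the sum of the two input surprisals. These are independent,
so `Var (A + B)` is the sum of the input varentropies, and it remains to show `Cov(A, B) ≥ 0`.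

The covariance splits into two parts along `Y`. Given `Y = y`, the less likely value of `U₁` has the
larger surprisal and also leaves more entropy in `U₂`, so the conditional covariance is nonnegative
(`polar_entropy_mul_le`). The conditional means of `A` and `B` are functions of the biases of the
two input bits, and both decrease in each bias. The biases are independent, so Harris' inequality
makes the means nonnegatively correlated (`integral_polar_entropy_mul_le`). Together these give
`varentropy_add_le`.

For `N = 2 ^ (n + 1)`, the pair step acts on the inputs `(0, c)` and `(1, c)` for each `c`, and the
length `2 ^ n` transform then acts on the sums and on the second bits separately. The side
information at each stage generates the same σ-algebra as in the full transform, which is all that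
varentropy sees (`varentropy_congr_comap`), so induction applies. -/

open scoped NNReal ENNReal

/-- `IsCondMass μ X Y p` says that `p y x` is a version of the conditional probability mass
function of the discrete random variable `X` given `Y = y`. -/
structure IsCondMass {Ω S α : Type*} [MeasurableSpace Ω] [MeasurableSpace S] [Fintype α]
    (μ : Measure Ω) (X : Ω → α) (Y : Ω → S) (p : S → α → ℝ≥0) : Prop where
  measurable : ∀ x, Measurable fun y => p y x
  lintegral_eq : ∀ G : S → α → ℝ≥0∞, (∀ x, Measurable fun y => G y x) →
    ∫⁻ ω, G (Y ω) (X ω) ∂μ = ∫⁻ ω, ∑ x, p (Y ω) x * G (Y ω) x ∂μ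

/-! ### Conditional mass functions and their calculus -/

section CondMass

variable {Ω S α β : Type*} [MeasurableSpace Ω] [MeasurableSpace S] [Fintype α] [Fintype β]
  {μ : Measure Ω}

/-- The regular conditional distribution of `X` given `Y`, as a mass function. -/
noncomputable def condMass (μ : Measure Ω) [IsFiniteMeasure μ] (X : Ω → ZMod 2) (Y : Ω → S) :
    S → ZMod 2 → ℝ≥0 :=
  fun y x => (condDistrib X Y μ y {x}).toNNReal

theorem isCondMass_condMass [IsFiniteMeasure μ] {X : Ω → ZMod 2} {Y : Ω → S}
    (hX : Measurable X) (hY : Measurable Y) : IsCondMass μ X Y (condMass μ X Y) where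
  measurable x := (Kernel.measurable_coe _ (measurableSet_singleton x)).ennreal_toNNReal
  lintegral_eq G hG := by
    have hG' : Measurable (fun z : S × ZMod 2 => G z.1 z.2) :=
      measurable_from_prod_countable_left hG
    have h1 : ∫⁻ ω, G (Y ω) (X ω) ∂μ = ∫⁻ z, G z.1 z.2 ∂(μ.map fun ω => (Y ω, X ω)) := by
      rw [lintegral_map hG' (hY.prodMk hX)]
    rw [h1, ← compProd_map_condDistrib hX.aemeasurable, Measure.lintegral_compProd hG',
      lintegral_map ?_ hY]
    · refine lintegral_congr fun ω => ?_
      rw [lintegral_fintype]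
      refine Finset.sum_congr rfl fun x _ => ?_
      rw [condMass, ENNReal.coe_toNNReal (measure_ne_top _ _), mul_comm]
    · exact hG'.lintegral_kernel_prod_right'

theorem condMass_add (μ : Measure Ω) [IsFiniteMeasure μ] (X : Ω → ZMod 2) (Y : Ω → S) (y : S) :
    condMass μ X Y y 0 + condMass μ X Y y 1 = 1 := by
  have h : condDistrib X Y μ y Set.univ = 1 := measure_univ
  have huniv : (Set.univ : Set (ZMod 2)) = {0} ∪ {1} := by
    refine (Set.eq_univ_of_forall fun x => ?_).symm
    revert x; simp only [Set.mem_union, Set.mem_singleton_iff]; decide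
  rw [huniv, measure_union (by simp) (measurableSet_singleton _)] at h
  rw [condMass, condMass, ← ENNReal.toNNReal_add (measure_ne_top _ _) (measure_ne_top _ _), h]
  rfl

namespace IsCondMass

/-- Testing against the indicator of `Y ∈ s` and `X = x` determines the integral of `p · x` over
every measurable `s` under the law of `Y`. This allows an explicit version to replace the regular
conditional distribution. -/
theorem ae_eq [IsFiniteMeasure μ] {X : Ω → α} {Y : Ω → S} {p q : S → α → ℝ≥0}
    (hY : Measurable Y) (hp : IsCondMass μ X Y p) (hq : IsCondMass μ X Y q) :
    ∀ᵐ ω ∂μ, ∀ x, p (Y ω) x = q (Y ω) x := by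
  classical
  rw [ae_all_iff]
  intro x
  have key : ∀ r : S → α → ℝ≥0, IsCondMass μ X Y r → ∀ s : Set S, MeasurableSet s →
      ∫⁻ y in s, r y x ∂(μ.map Y)
        = ∫⁻ ω, s.indicator 1 (Y ω) * (if X ω = x then 1 else 0) ∂μ := by
    intro r hr s hs
    rw [hr.lintegral_eq (fun y x' => s.indicator 1 y * (if x' = x then 1 else 0))
      (fun x' => (measurable_one.indicator hs).mul_const _), ← lintegral_indicator hs,
      lintegral_map ((hr.measurable x).coe_nnreal_ennreal.indicator hs) hY]
    refine lintegral_congr fun ω => ?_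
    by_cases h : Y ω ∈ s <;> simp [h]
  have h := ae_eq_of_forall_setLIntegral_eq_of_sigmaFinite (μ := μ.map Y)
    (hp.measurable x).coe_nnreal_ennreal (hq.measurable x).coe_nnreal_ennreal
    (fun s hs _ => (key p hp s hs).trans (key q hq s hs).symm)
  filter_upwards [ae_of_ae_map hY.aemeasurable h] with ω hω
  exact_mod_cast hω

/-- The test function that indicates `p y x = 0` has zero weighted sum. The result is what allows
logarithms of products and quotients to be split almost surely. -/
theorem ae_pos {X : Ω → α} {Y : Ω → S} {p : S → α → ℝ≥0}
    [MeasurableSpace α] [MeasurableSingletonClass α]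
    (hX : Measurable X) (hY : Measurable Y) (hp : IsCondMass μ X Y p) :
    ∀ᵐ ω ∂μ, p (Y ω) (X ω) ≠ 0 := by
  have h := hp.lintegral_eq (fun y x => if p y x = 0 then 1 else 0)
    (fun x => Measurable.ite (hp.measurable x (measurableSet_singleton 0))
      measurable_const measurable_const)
  have h0 : ∀ ω, ∑ x, (p (Y ω) x : ℝ≥0∞) * (if p (Y ω) x = 0 then 1 else 0) = 0 := fun ω =>
    Finset.sum_eq_zero fun x _ => by split_ifs with hx <;> simp [hx]
  simp only [h0, lintegral_zero] at h
  have hm : Measurable fun ω => p (Y ω) (X ω) :=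
    (measurable_from_prod_countable_left (f := fun z : S × α => p z.1 z.2) hp.measurable).comp
      (hY.prodMk hX)
  have hm' : Measurable fun ω => if p (Y ω) (X ω) = 0 then (1 : ℝ≥0∞) else 0 :=
    Measurable.ite (hm (measurableSet_singleton 0)) measurable_const measurable_const
  rw [lintegral_eq_zero_iff hm'] at h
  filter_upwards [h] with ω hω
  by_contra hne
  simp [hne] at hω

theorem map_equiv {X : Ω → α} {Y : Ω → S} {p : S → α → ℝ≥0} (hp : IsCondMass μ X Y p)
    (e : α ≃ β) : IsCondMass μ (fun ω => e (X ω)) Y (fun y z => p y (e.symm z)) where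
  measurable z := hp.measurable _
  lintegral_eq G hG := by
    rw [hp.lintegral_eq (fun y x => G y (e x)) (fun x => hG _)]
    refine lintegral_congr fun ω => Fintype.sum_equiv e _ _ fun x => by simp

theorem fst {X : Ω → α} {Z : Ω → β} {Y : Ω → S} {p : S → α × β → ℝ≥0}
    (hp : IsCondMass μ (fun ω => (X ω, Z ω)) Y p) :
    IsCondMass μ X Y (fun y x => ∑ z, p y (x, z)) where
  measurable x := Finset.measurable_sum _ fun z _ => hp.measurable _
  lintegral_eq G hG := by
    rw [hp.lintegral_eq (fun y w => G y w.1) (fun w => hG _)]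
    refine lintegral_congr fun ω => ?_
    simp [Fintype.sum_prod_type, Finset.sum_mul]

theorem snd_given_fst [MeasurableSpace α] [MeasurableSingletonClass α]
    {X : Ω → α} {Z : Ω → β} {Y : Ω → S} {p : S → α × β → ℝ≥0}
    (hp : IsCondMass μ (fun ω => (X ω, Z ω)) Y p) :
    IsCondMass μ Z (fun ω => (X ω, Y ω))
      (fun w z => p w.2 (w.1, z) / ∑ z', p w.2 (w.1, z')) where
  measurable z := measurable_from_prod_countable_right fun x =>
    (hp.measurable (x, z)).div (hp.fst.measurable x)
  lintegral_eq G hG := by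
    have hG' : ∀ x z, Measurable fun y => G (x, y) z := fun x z =>
      (hG z).comp measurable_prodMk_left
    rw [hp.lintegral_eq (fun y w => G (w.1, y) w.2) (fun w => hG' _ _),
      hp.fst.lintegral_eq (fun y x => ∑ z, ((p y (x, z) / ∑ z', p y (x, z') : ℝ≥0) : ℝ≥0∞) *
        G (x, y) z)
      (fun x => Finset.measurable_sum _ fun z _ =>
        ((hp.measurable (x, z)).div (hp.fst.measurable x)).coe_nnreal_ennreal.mul (hG' x z))]
    refine lintegral_congr fun ω => ?_
    rw [Fintype.sum_prod_type]
    refine Finset.sum_congr rfl fun x _ => ?_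
    rw [Finset.mul_sum]
    refine Finset.sum_congr rfl fun z _ => ?_
    rw [← mul_assoc, ← ENNReal.coe_mul]
    congr 2
    -- Where the marginal mass vanishes, so does every joint mass, so the convention `0 / 0 = 0`
    -- does no harm.
    rcases eq_or_ne (∑ z', p (Y ω) (x, z')) 0 with h | h
    · rw [h, zero_mul]
      exact (Finset.sum_eq_zero_iff.1 h) z (Finset.mem_univ z)
    · rw [mul_div_cancel₀ _ h]

end IsCondMass

theorem lintegral_indepFun [IsProbabilityMeasure μ] {T₁ T₂ : Type*} [MeasurableSpace T₁]
    [MeasurableSpace T₂] {Z₁ : Ω → T₁} {Z₂ : Ω → T₂} (h₁ : Measurable Z₁) (h₂ : Measurable Z₂)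
    (hind : IndepFun Z₁ Z₂ μ) {F : T₁ → T₂ → ℝ≥0∞}
    (hF : Measurable fun z : T₁ × T₂ => F z.1 z.2) :
    ∫⁻ ω, F (Z₁ ω) (Z₂ ω) ∂μ = ∫⁻ ω₁, ∫⁻ ω₂, F (Z₁ ω₁) (Z₂ ω₂) ∂μ ∂μ := by
  have := (indepFun_iff_map_prod_eq_prod_map_map h₁.aemeasurable h₂.aemeasurable).1 hind
  have e : ∫⁻ ω, F (Z₁ ω) (Z₂ ω) ∂μ
      = ∫⁻ z, F z.1 z.2 ∂(μ.map fun ω => (Z₁ ω, Z₂ ω)) := by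
    rw [lintegral_map hF (h₁.prodMk h₂)]
  rw [e, this, lintegral_prod _ hF.aemeasurable, lintegral_map hF.lintegral_prod_right' h₁]
  refine lintegral_congr fun ω => ?_
  exact lintegral_map (hF.comp measurable_prodMk_left) h₂

/-- Independence turns the integral into an iterated one over two copies of `Ω`. Each bit is
averaged out while its copy is the inner variable, with Tonelli in between; independence of `Y₁` and
`Y₂` then merges the copies again. -/
theorem IsCondMass.prod [IsProbabilityMeasure μ] {T : Type*} [MeasurableSpace T]
    [MeasurableSpace α] [MeasurableSingletonClass α] [MeasurableSpace β]
    [MeasurableSingletonClass β] {X₁ : Ω → α} {X₂ : Ω → β} {Y₁ : Ω → S} {Y₂ : Ω → T}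
    {p : S → α → ℝ≥0} {q : T → β → ℝ≥0}
    (hX₁ : Measurable X₁) (hX₂ : Measurable X₂) (hY₁ : Measurable Y₁) (hY₂ : Measurable Y₂)
    (hind : IndepFun (fun ω => (X₁ ω, Y₁ ω)) (fun ω => (X₂ ω, Y₂ ω)) μ)
    (hp : IsCondMass μ X₁ Y₁ p) (hq : IsCondMass μ X₂ Y₂ q) :
    IsCondMass μ (fun ω => (X₁ ω, X₂ ω)) (fun ω => (Y₁ ω, Y₂ ω))
      (fun y x => p y.1 x.1 * q y.2 x.2) where
  measurable x := ((hp.measurable x.1).comp measurable_fst).mul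
    ((hq.measurable x.2).comp measurable_snd)
  lintegral_eq G hG := by
    have hG' : Measurable fun z : (S × T) × (α × β) => G z.1 z.2 :=
      measurable_from_prod_countable_left hG
    have hpm : ∀ x, Measurable fun y => (p y x : ℝ≥0∞) := fun x =>
      (hp.measurable x).coe_nnreal_ennreal
    have hqm : ∀ x, Measurable fun y => (q y x : ℝ≥0∞) := fun x =>
      (hq.measurable x).coe_nnreal_ennreal
    have hYY : IndepFun Y₁ Y₂ μ := hind.comp measurable_snd measurable_snd
    rw [lintegral_indepFun (hX₁.prodMk hY₁) (hX₂.prodMk hY₂) hind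
      (F := fun z w => G (z.2, w.2) (z.1, w.1))
      (hG'.comp (f := fun z : (α × S) × (β × T) => ((z.1.2, z.2.2), (z.1.1, z.2.1)))
        (by fun_prop)),
      lintegral_indepFun hY₁ hY₂ hYY (F := fun y₁ y₂ => ∑ x : α × β,
        ((p y₁ x.1 * q y₂ x.2 : ℝ≥0) : ℝ≥0∞) * G (y₁, y₂) x)
      (Finset.measurable_sum _ fun x _ => by
        push_cast
        exact (((hpm x.1).comp measurable_fst).mul ((hqm x.2).comp measurable_snd)).mul (hG x))]
    calc ∫⁻ ω₁, ∫⁻ ω₂, G (Y₁ ω₁, Y₂ ω₂) (X₁ ω₁, X₂ ω₂) ∂μ ∂μ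
        = ∫⁻ ω₁, ∫⁻ ω₂, ∑ x₂, q (Y₂ ω₂) x₂ * G (Y₁ ω₁, Y₂ ω₂) (X₁ ω₁, x₂) ∂μ ∂μ := by
          refine lintegral_congr fun ω₁ => ?_
          exact hq.lintegral_eq (fun y x => G (Y₁ ω₁, y) (X₁ ω₁, x))
            (fun x => (hG _).comp measurable_prodMk_left)
      _ = ∫⁻ ω₂, ∫⁻ ω₁, ∑ x₂, q (Y₂ ω₂) x₂ * G (Y₁ ω₁, Y₂ ω₂) (X₁ ω₁, x₂) ∂μ ∂μ := by
          refine lintegral_lintegral_swap (Measurable.aemeasurable ?_)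
          refine Finset.measurable_sum _ fun x _ => ?_
          exact ((hqm x).comp (hY₂.comp measurable_snd)).mul (hG'.comp
            (f := fun z : Ω × Ω => ((Y₁ z.1, Y₂ z.2), (X₁ z.1, x))) (by fun_prop))
      _ = ∫⁻ ω₂, ∫⁻ ω₁, ∑ x₁, p (Y₁ ω₁) x₁ *
            ∑ x₂, q (Y₂ ω₂) x₂ * G (Y₁ ω₁, Y₂ ω₂) (x₁, x₂) ∂μ ∂μ := by
          refine lintegral_congr fun ω₂ => ?_
          exact hp.lintegral_eq (fun y x => ∑ x₂, q (Y₂ ω₂) x₂ * G (y, Y₂ ω₂) (x, x₂))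
            (fun x => Finset.measurable_sum _ fun x₂ _ =>
              ((hG _).comp measurable_prodMk_right).const_mul _)
      _ = ∫⁻ ω₁, ∫⁻ ω₂, ∑ x₁, p (Y₁ ω₁) x₁ *
            ∑ x₂, q (Y₂ ω₂) x₂ * G (Y₁ ω₁, Y₂ ω₂) (x₁, x₂) ∂μ ∂μ := by
          refine lintegral_lintegral_swap (Measurable.aemeasurable ?_)
          refine Finset.measurable_sum _ fun x _ => ?_
          refine ((hpm x).comp (hY₁.comp measurable_snd)).mul
            (Finset.measurable_sum _ fun x₂ _ => ?_)
          exact ((hqm x₂).comp (hY₂.comp measurable_fst)).mul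
            ((hG (x, x₂)).comp ((hY₁.comp measurable_snd).prodMk (hY₂.comp measurable_fst)))
      _ = _ := by
          refine lintegral_congr fun ω₁ => lintegral_congr fun ω₂ => ?_
          simp [Fintype.sum_prod_type, Finset.mul_sum, mul_assoc]

theorem IsCondMass.integral_eq {X : Ω → α} {Y : Ω → S} {p : S → α → ℝ≥0}
    [MeasurableSpace α] [MeasurableSingletonClass α] (hX : Measurable X) (hY : Measurable Y)
    (hp : IsCondMass μ X Y p) {G : S → α → ℝ} (hG : ∀ x, Measurable fun y => G y x)
    (hG0 : ∀ y x, 0 ≤ G y x) :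
    ∫ ω, G (Y ω) (X ω) ∂μ = ∫ ω, ∑ x, p (Y ω) x * G (Y ω) x ∂μ := by
  have hm : Measurable fun ω => G (Y ω) (X ω) :=
    (measurable_from_prod_countable_left (f := fun z : S × α => G z.1 z.2) hG).comp
      (hY.prodMk hX)
  rw [integral_eq_lintegral_of_nonneg_ae (.of_forall fun ω => hG0 _ _) hm.aestronglyMeasurable,
    integral_eq_lintegral_of_nonneg_ae (f := fun ω => ∑ x, (p (Y ω) x : ℝ) * G (Y ω) x)
      (.of_forall fun ω => Finset.sum_nonneg fun x _ => mul_nonneg (NNReal.coe_nonneg _) (hG0 _ _))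
      (Finset.measurable_sum _ fun x _ => ((hp.measurable x).comp hY).coe_nnreal_real.mul
        ((hG x).comp hY)).aestronglyMeasurable,
    hp.lintegral_eq (fun y x => ENNReal.ofReal (G y x)) (fun x => (hG x).ennreal_ofReal)]
  congr 1
  refine lintegral_congr fun ω => ?_
  rw [ENNReal.ofReal_sum_of_nonneg (f := fun x => (p (Y ω) x : ℝ) * G (Y ω) x)
    fun x _ => mul_nonneg (NNReal.coe_nonneg _) (hG0 _ _)]
  refine Finset.sum_congr rfl fun x _ => ?_
  rw [ENNReal.ofReal_mul (NNReal.coe_nonneg _), ENNReal.ofReal_coe_nnreal]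

end CondMass

/-! ### Binary entropy inequalities, conditionally on the channel outputs -/

section BinaryEntropy

open Real

/-- Binary entropy is symmetric about `1/2` and increasing on `[0, 1/2]`, hence an increasing
function of `p * (1 - p)`. -/
theorem binEntropy_le_binEntropy_of_mul_one_sub_le {p q : ℝ} (hp0 : 0 ≤ p) (hp1 : p ≤ 1)
    (hq0 : 0 ≤ q) (hq1 : q ≤ 1) (h : p * (1 - p) ≤ q * (1 - q)) :
    binEntropy p ≤ binEntropy q := by
  wlog hp : p ≤ 2⁻¹ generalizing p
  · rw [← binEntropy_one_sub p]
    exact this (by linarith) (by linarith) (by linarith) (by norm_num at hp ⊢; linarith)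
  wlog hq : q ≤ 2⁻¹ generalizing q
  · rw [← binEntropy_one_sub q]
    exact this (by linarith) (by linarith) (by linarith) (by norm_num at hq ⊢; linarith)
  refine binEntropy_strictMonoOn.monotoneOn ⟨hp0, hp⟩ ⟨hq0, hq⟩ ?_
  by_contra! hlt
  norm_num at hp hq
  nlinarith [mul_pos (sub_pos.2 hlt) (show 0 < 1 - p - q by linarith)]

/-- The entropy of a bit with bias `s`, that is, taking one value with probability `(1 - s) / 2`. -/
noncomputable def biasEntropy (s : ℝ) : ℝ := binEntropy ((1 - s) / 2)

theorem continuous_biasEntropy : Continuous biasEntropy :=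
  binEntropy_continuous.comp (by fun_prop)

theorem biasEntropy_abs (x : ℝ) : biasEntropy |1 - 2 * x| = binEntropy x := by
  rcases abs_cases (1 - 2 * x) with ⟨h, _⟩ | ⟨h, _⟩
  · rw [biasEntropy, h]; congr 1; ring
  · rw [biasEntropy, h, ← binEntropy_one_sub x]; congr 1; ring

theorem biasEntropy_antitoneOn : AntitoneOn biasEntropy (Set.Icc 0 1) := by
  intro s hs t ht hst
  refine binEntropy_strictMonoOn.monotoneOn ?_ ?_ (by linarith) <;>
    constructor <;> norm_num <;> linarith [hs.1, hs.2, ht.1, ht.2]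

theorem biasEntropy_concaveOn : ConcaveOn ℝ (Set.Icc 0 1) biasEntropy := by
  refine ⟨convex_Icc 0 1, fun x hx y hy a b ha hb hab => ?_⟩
  have h := strictConcave_binEntropy.concaveOn.2 (x := (1 - x) / 2) (y := (1 - y) / 2)
    ⟨by linarith [hx.2], by linarith [hx.1]⟩ ⟨by linarith [hy.2], by linarith [hy.1]⟩ ha hb hab
  refine h.trans (le_of_eq ?_)
  rw [biasEntropy]
  congr 1
  simp only [smul_eq_mul]
  linear_combination (1 / 2) * hab

theorem biasEntropy_nonneg {s : ℝ} (h0 : 0 ≤ s) (h1 : s ≤ 1) : 0 ≤ biasEntropy s :=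
  binEntropy_nonneg (by linarith) (by linarith)

theorem biasEntropy_le (s : ℝ) : biasEntropy s ≤ log 2 := binEntropy_le_log_two

/-- This makes the mean surprisal of the second output decreasing in each bias. The points `s` and
`c * s + (t - s)` are convex combinations of `c * s` and `t` with exchanged weights, so concavity
bounds the sum of the end values by the sum of the inner ones. Since `c * t ≤ c * s + (t - s)`,
monotonicity finishes. -/
theorem biasEntropy_sub_le {c s t : ℝ} (hc0 : 0 ≤ c) (hc1 : c ≤ 1) (hs : 0 ≤ s) (hst : s ≤ t)
    (ht : t ≤ 1) :
    biasEntropy t - biasEntropy (c * t) ≤ biasEntropy s - biasEntropy (c * s) := by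
  -- The case `s = t` is separated because `t - c * s`, the denominator of the weight, could then
  -- vanish.
  rcases hst.eq_or_lt with rfl | hlt
  · rfl
  have hcs : c * s ≤ s := mul_le_of_le_one_left hs hc1
  have hcs0 : 0 ≤ c * s := mul_nonneg hc0 hs
  have hd : 0 < t - c * s := by linarith
  set l := (t - s) / (t - c * s) with hl
  have hl0 : 0 ≤ l := div_nonneg (by linarith) hd.le
  have hl1 : l ≤ 1 := (div_le_one hd).2 (by linarith)
  have hlm : l * (t - c * s) = t - s := div_mul_cancel₀ _ hd.ne'
  have m1 : c * s ∈ Set.Icc (0 : ℝ) 1 := ⟨hcs0, by linarith⟩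
  have m2 : t ∈ Set.Icc (0 : ℝ) 1 := ⟨by linarith, ht⟩
  have e1 := biasEntropy_concaveOn.2 m1 m2 hl0 (sub_nonneg.2 hl1) (by ring)
  have e2 := biasEntropy_concaveOn.2 m1 m2 (sub_nonneg.2 hl1) hl0 (by ring)
  simp only [smul_eq_mul] at e1 e2
  rw [show l * (c * s) + (1 - l) * t = s by linear_combination -hlm] at e1
  rw [show (1 - l) * (c * s) + l * t = c * s + (t - s) by linear_combination hlm] at e2
  have hct : c * t ≤ c * s + (t - s) := by
    nlinarith [mul_nonneg (sub_nonneg.2 hc1) (sub_nonneg.2 hst)]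
  have e3 : biasEntropy (c * s + (t - s)) ≤ biasEntropy (c * t) :=
    biasEntropy_antitoneOn ⟨mul_nonneg hc0 m2.1, by linarith⟩ ⟨by linarith, by linarith⟩ hct
  linarith

theorem mul_neg_log_div (x : ℝ) {r : ℝ} (h : r = 0 → x = 0) :
    x * -log (x / r) = negMulLog x + x * log r := by
  rcases eq_or_ne x 0 with rfl | hx
  · simp
  · rw [log_div hx fun hr => hx (h hr), negMulLog]; ring

variable {p₀ p₁ q₀ q₁ : ℝ}

/-- Chain rule: the entropy of the pair of inputs equals that of the pair of outputs, so the
conditional entropy of the second output is the total minus that of the first. -/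
theorem cond_entropy_add_eq (hp₀ : 0 ≤ p₀) (hp₁ : 0 ≤ p₁) (hq₀ : 0 ≤ q₀) (hq₁ : 0 ≤ q₁)
    (hp : p₀ + p₁ = 1) (hq : q₀ + q₁ = 1) :
    p₀ * q₀ * -log (p₀ * q₀ / (p₀ * q₀ + p₁ * q₁))
      + p₁ * q₁ * -log (p₁ * q₁ / (p₀ * q₀ + p₁ * q₁))
      + (p₁ * q₀ * -log (p₁ * q₀ / (p₁ * q₀ + p₀ * q₁))
        + p₀ * q₁ * -log (p₀ * q₁ / (p₁ * q₀ + p₀ * q₁)))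
    = binEntropy p₁ + binEntropy q₁ - binEntropy (p₁ * q₀ + p₀ * q₁) := by
  have h00 := mul_nonneg hp₀ hq₀
  have h11 := mul_nonneg hp₁ hq₁
  have h10 := mul_nonneg hp₁ hq₀
  have h01 := mul_nonneg hp₀ hq₁
  rw [mul_neg_log_div _ fun h => by linarith, mul_neg_log_div _ fun h => by linarith,
    mul_neg_log_div _ fun h => by linarith, mul_neg_log_div _ fun h => by linarith]
  simp only [negMulLog_mul, binEntropy_eq_negMulLog_add_negMulLog_one_sub]
  rw [show 1 - (p₁ * q₀ + p₀ * q₁) = p₀ * q₀ + p₁ * q₁ by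
    linear_combination (-q₀ - q₁) * hp - hq, show 1 - p₁ = p₀ by linarith,
    show 1 - q₁ = q₀ by linarith]
  simp only [negMulLog]
  linear_combination (-q₀ * log q₀ - q₁ * log q₁) * hp + (-p₀ * log p₀ - p₁ * log p₁) * hq

/-- A covariance on a two-point space is the product of the two weights and the two increments. Here
`r` is the law of the first output and `H` the entropy left in the second; the hypotheses give the
increments equal signs. They are required only when both weights are positive, since otherwise the
covariance is zero. -/
theorem mul_le_of_binary_chain {r₀ r₁ E₀ E₁ H₀ H₁ : ℝ} (hr₀ : 0 ≤ r₀) (hr₁ : 0 ≤ r₁)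
    (hr : r₀ + r₁ = 1) (hE₀ : E₀ = r₀ * H₀) (hE₁ : E₁ = r₁ * H₁)
    (hH : 0 < r₀ → 0 < r₁ → r₁ ≤ r₀ → H₀ ≤ H₁) (hH' : 0 < r₀ → 0 < r₁ → r₀ ≤ r₁ → H₁ ≤ H₀) :
    (r₀ * -log r₀ + r₁ * -log r₁) * (E₀ + E₁) ≤ -log r₀ * E₀ + -log r₁ * E₁ := by
  suffices h : 0 ≤ r₀ * r₁ * ((log r₁ - log r₀) * (H₀ - H₁)) by
    subst hE₀ hE₁
    have e : -log r₀ * (r₀ * H₀) + -log r₁ * (r₁ * H₁)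
        - (r₀ * -log r₀ + r₁ * -log r₁) * (r₀ * H₀ + r₁ * H₁)
        = r₀ * r₁ * ((log r₁ - log r₀) * (H₀ - H₁)) := by
      obtain rfl : r₁ = 1 - r₀ := by linarith
      ring
    linarith
  rcases hr₀.eq_or_lt with h0 | h0
  · simp [← h0]
  rcases hr₁.eq_or_lt with h1 | h1
  · simp [← h1]
  refine mul_nonneg (mul_pos h0 h1).le ?_
  rcases le_total r₁ r₀ with h | h
  · exact mul_nonneg_of_nonpos_of_nonpos (by linarith [log_le_log h1 h]) (by linarith [hH h0 h1 h])
  · exact mul_nonneg (by linarith [log_le_log h0 h]) (by linarith [hH' h0 h1 h])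

theorem mul_neg_log_div_add (x y : ℝ) (hx : 0 ≤ x) (hy : 0 ≤ y) :
    x * -log (x / (x + y)) + y * -log (y / (x + y)) = (x + y) * binEntropy (y / (x + y)) := by
  rcases (add_nonneg hx hy).eq_or_lt with h | h
  · obtain rfl : x = 0 := by linarith
    obtain rfl : y = 0 := by linarith
    simp
  · rw [binEntropy_eq_negMulLog_add_negMulLog_one_sub,
      show 1 - y / (x + y) = x / (x + y) by field_simp; ring, negMulLog, negMulLog]
    field_simp
    ring

/-- Given the channel outputs, the entropies of the two outputs of the polar transform of a pair
of independent bits are nonnegatively correlated. -/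
theorem polar_entropy_mul_le (hp₀ : 0 ≤ p₀) (hp₁ : 0 ≤ p₁) (hq₀ : 0 ≤ q₀) (hq₁ : 0 ≤ q₁)
    (hp : p₀ + p₁ = 1) (hq : q₀ + q₁ = 1) :
    ((p₀ * q₀ + p₁ * q₁) * -log (p₀ * q₀ + p₁ * q₁)
      + (p₁ * q₀ + p₀ * q₁) * -log (p₁ * q₀ + p₀ * q₁)) *
    (p₀ * q₀ * -log (p₀ * q₀ / (p₀ * q₀ + p₁ * q₁))
      + p₁ * q₁ * -log (p₁ * q₁ / (p₀ * q₀ + p₁ * q₁))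
      + (p₁ * q₀ * -log (p₁ * q₀ / (p₁ * q₀ + p₀ * q₁))
        + p₀ * q₁ * -log (p₀ * q₁ / (p₁ * q₀ + p₀ * q₁)))) ≤
    -log (p₀ * q₀ + p₁ * q₁) * (p₀ * q₀ * -log (p₀ * q₀ / (p₀ * q₀ + p₁ * q₁))
      + p₁ * q₁ * -log (p₁ * q₁ / (p₀ * q₀ + p₁ * q₁)))
    + -log (p₁ * q₀ + p₀ * q₁) * (p₁ * q₀ * -log (p₁ * q₀ / (p₁ * q₀ + p₀ * q₁))
        + p₀ * q₁ * -log (p₀ * q₁ / (p₁ * q₀ + p₀ * q₁))) := by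
  have h00 := mul_nonneg hp₀ hq₀
  have h11 := mul_nonneg hp₁ hq₁
  have h10 := mul_nonneg hp₁ hq₀
  have h01 := mul_nonneg hp₀ hq₁
  set r₀ := p₀ * q₀ + p₁ * q₁ with hr₀
  set r₁ := p₁ * q₀ + p₀ * q₁ with hr₁
  have hr₀0 : 0 ≤ r₀ := add_nonneg h00 h11
  have hr₁0 : 0 ≤ r₁ := add_nonneg h10 h01
  -- The posterior variances for the two values of the first output share the numerator `p₀ q₀ p₁
  -- q₁`. The smaller `r` therefore has the larger posterior variance, hence the larger entropy.
  have e₀ : 0 < r₀ → p₁ * q₁ / r₀ * (1 - p₁ * q₁ / r₀) = p₀ * q₀ * (p₁ * q₁) / r₀ ^ 2 := by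
    intro h
    field_simp
    rw [hr₀]; ring
  have e₁ : 0 < r₁ → p₀ * q₁ / r₁ * (1 - p₀ * q₁ / r₁) = p₀ * q₀ * (p₁ * q₁) / r₁ ^ 2 := by
    intro h
    field_simp
    rw [hr₁]; ring
  have b₀ : 0 < r₀ → 0 ≤ p₁ * q₁ / r₀ ∧ p₁ * q₁ / r₀ ≤ 1 := fun h =>
    ⟨by positivity, (div_le_one h).2 (by linarith)⟩
  have b₁ : 0 < r₁ → 0 ≤ p₀ * q₁ / r₁ ∧ p₀ * q₁ / r₁ ≤ 1 := fun h =>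
    ⟨by positivity, (div_le_one h).2 (by linarith)⟩
  refine mul_le_of_binary_chain hr₀0 hr₁0 ?_ (mul_neg_log_div_add _ _ h00 h11)
    (mul_neg_log_div_add _ _ h10 h01) (fun h0 h1 h => ?_) (fun h0 h1 h => ?_)
  · rw [hr₀, hr₁]; linear_combination (q₀ + q₁) * hp + hq
  · refine binEntropy_le_binEntropy_of_mul_one_sub_le (b₀ h0).1 (b₀ h0).2 (b₁ h1).1 (b₁ h1).2 ?_
    rw [e₀ h0, e₁ h1]
    gcongr
  · refine binEntropy_le_binEntropy_of_mul_one_sub_le (b₁ h1).1 (b₁ h1).2 (b₀ h0).1 (b₀ h0).2 ?_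
    rw [e₀ h0, e₁ h1]
    gcongr

end BinaryEntropy

/-! ### Correlation inequalities of Chebyshev and Harris -/

section Harris

/-- **Chebyshev's association inequality.** -/
theorem integral_mul_integral_le_integral_mul {S : Type*} [MeasurableSpace S] {ν : Measure S}
    [IsProbabilityMeasure ν] {f g : S → ℝ} (hf : Integrable f ν) (hg : Integrable g ν)
    (hfg : Integrable (fun x => f x * g x) ν)
    (h : ∀ x y, 0 ≤ (f x - f y) * (g x - g y)) :
    (∫ x, f x ∂ν) * ∫ x, g x ∂ν ≤ ∫ x, f x * g x ∂ν := by
  set F := ∫ x, f x ∂ν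
  set G := ∫ x, g x ∂ν
  set K := ∫ x, f x * g x ∂ν
  -- The product of increments is integrated over `x` here and over `y` in `h2`, leaving `2 * (K - F
  -- * G)`.
  have h1 : ∀ y, 0 ≤ (K - g y * F) - (f y * G - f y * g y) := by
    intro y
    have e : ∫ x, (f x - f y) * (g x - g y) ∂ν = (K - g y * F) - (f y * G - f y * g y) := by
      have e' : ∀ x, (f x - f y) * (g x - g y)
          = (f x * g x - g y * f x) - (f y * g x - f y * g y) := fun x => by ring
      simp only [e']
      have i1 : Integrable (fun x => f x * g x - g y * f x) ν := hfg.sub (hf.const_mul _)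
      have i2 : Integrable (fun x => f y * g x - f y * g y) ν :=
        (hg.const_mul _).sub (integrable_const _)
      rw [integral_sub i1 i2, integral_sub hfg (hf.const_mul _),
        integral_sub (hg.const_mul _) (integrable_const _),
        integral_const_mul, integral_const_mul]
      simp [K, F, G]
    rw [← e]
    exact integral_nonneg fun x => h x y
  have h2 : 0 ≤ ∫ y, ((K - g y * F) - (f y * G - f y * g y)) ∂ν := integral_nonneg fun y => h1 y
  have i1 : Integrable (fun y => K - g y * F) ν := (integrable_const _).sub (hg.mul_const _)
  have i2 : Integrable (fun y => f y * G - f y * g y) ν := (hf.mul_const _).sub hfg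
  rw [integral_sub i1 i2, integral_sub (integrable_const _) (hg.mul_const _),
    integral_sub (hf.mul_const _) hfg,
    integral_mul_const, integral_mul_const] at h2
  simp only [integral_const, probReal_univ, one_smul] at h2
  change 0 ≤ K - G * F - (F * G - K) at h2
  linarith

/-- **Harris' inequality** for two independent variables. -/
theorem integral_mul_integral_le_integral_mul_prod {S T : Type*} [MeasurableSpace S]
    [MeasurableSpace T] {ν₁ : Measure S} {ν₂ : Measure T} [IsProbabilityMeasure ν₁]
    [IsProbabilityMeasure ν₂] {f g : S × T → ℝ} (hf : Measurable f) (hg : Measurable g) {C : ℝ}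
    (hfC : ∀ z, |f z| ≤ C) (hgC : ∀ z, |g z| ≤ C)
    (h₁ : ∀ y x x', 0 ≤ (f (x, y) - f (x', y)) * (g (x, y) - g (x', y)))
    (h₂ : ∀ y y', (∀ x, f (x, y) ≤ f (x, y') ∧ g (x, y) ≤ g (x, y')) ∨
      (∀ x, f (x, y') ≤ f (x, y) ∧ g (x, y') ≤ g (x, y))) :
    (∫ z, f z ∂(ν₁.prod ν₂)) * ∫ z, g z ∂(ν₁.prod ν₂) ≤ ∫ z, f z * g z ∂(ν₁.prod ν₂) := by
  have hfgC : ∀ z, |f z * g z| ≤ C * C := fun z => by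
    rw [abs_mul]
    exact mul_le_mul (hfC z) (hgC z) (abs_nonneg _) ((abs_nonneg _).trans (hfC z))
  have hfi : Integrable f (ν₁.prod ν₂) := .of_bound hf.aestronglyMeasurable C (.of_forall hfC)
  have hgi : Integrable g (ν₁.prod ν₂) := .of_bound hg.aestronglyMeasurable C (.of_forall hgC)
  have hfgi : Integrable (fun z => f z * g z) (ν₁.prod ν₂) :=
    .of_bound (hf.mul hg).aestronglyMeasurable (C * C) (.of_forall hfgC)
  have hfs : ∀ y, Integrable (fun x => f (x, y)) ν₁ := fun y =>
    .of_bound (hf.comp measurable_prodMk_right).aestronglyMeasurable C (.of_forall fun x => hfC _)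
  have hgs : ∀ y, Integrable (fun x => g (x, y)) ν₁ := fun y =>
    .of_bound (hg.comp measurable_prodMk_right).aestronglyMeasurable C (.of_forall fun x => hgC _)
  have hfgs : ∀ y, Integrable (fun x => f (x, y) * g (x, y)) ν₁ := fun y =>
    .of_bound ((hf.mul hg).comp measurable_prodMk_right).aestronglyMeasurable (C * C)
      (.of_forall fun x => hfgC _)
  rw [integral_prod_symm _ hfi, integral_prod_symm _ hgi, integral_prod_symm _ hfgi]
  have hFG : Integrable (fun y => (∫ x, f (x, y) ∂ν₁) * ∫ x, g (x, y) ∂ν₁) ν₂ := by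
    refine .of_bound (hfi.integral_prod_right.aestronglyMeasurable.mul
      hgi.integral_prod_right.aestronglyMeasurable) (C * C) (.of_forall fun y => ?_)
    have b : ∀ k : S × T → ℝ, (∀ z, |k z| ≤ C) → |∫ x, k (x, y) ∂ν₁| ≤ C := fun k hk => by
      simpa using norm_integral_le_of_norm_le_const (μ := ν₁) (f := fun x => k (x, y))
        (.of_forall fun x => hk (x, y))
    rw [Real.norm_eq_abs, abs_mul]
    exact mul_le_mul (b f hfC) (b g hgC) (abs_nonneg _) ((abs_nonneg _).trans (b f hfC))
  -- Chebyshev's inequality is used twice: for the averages over `x`, which `h₂` orders alike as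
  -- functions of `y`, and then on each section, by `h₁`.
  calc _ ≤ ∫ y, (∫ x, f (x, y) ∂ν₁) * ∫ x, g (x, y) ∂ν₁ ∂ν₂ := by
        refine integral_mul_integral_le_integral_mul hfi.integral_prod_right
          hgi.integral_prod_right hFG fun y y' => ?_
        rcases h₂ y y' with h | h
        · exact mul_nonneg_of_nonpos_of_nonpos
            (sub_nonpos.2 (integral_mono (hfs y) (hfs y') fun x => (h x).1))
            (sub_nonpos.2 (integral_mono (hgs y) (hgs y') fun x => (h x).2))
        · exact mul_nonneg
            (sub_nonneg.2 (integral_mono (hfs y') (hfs y) fun x => (h x).1))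
            (sub_nonneg.2 (integral_mono (hgs y') (hgs y) fun x => (h x).2))
    _ ≤ _ := integral_mono hFG hfgi.integral_prod_right fun y =>
        integral_mul_integral_le_integral_mul (hfs y) (hgs y) (hfgs y) (h₁ y)

end Harris

/-! ### Surprisals: square-integrability and dependence on the σ-algebra -/

section EntropyRV

theorem sum_zmod_two {M : Type*} [AddCommMonoid M] (f : ZMod 2 → M) : ∑ x, f x = f 0 + f 1 :=
  Fin.sum_univ_two f

variable {Ω S : Type*} [MeasurableSpace Ω] [mS : MeasurableSpace S] {μ : Measure Ω}

theorem condMass_le_one (μ : Measure Ω) [IsFiniteMeasure μ] (X : Ω → ZMod 2) (Y : Ω → S)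
    (y : S) (x : ZMod 2) : condMass μ X Y y x ≤ 1 := by
  have h : condDistrib X Y μ y {x} ≤ 1 := prob_le_one
  simpa [condMass] using ENNReal.toNNReal_mono ENNReal.one_ne_top h

theorem condEntropyRV_eq_condMass [IsFiniteMeasure μ] (X : Ω → ZMod 2) (Y : Ω → S) :
    condEntropyRV μ X Y =
      fun ω => (Real.log 2)⁻¹ * -Real.log (condMass μ X Y (Y ω) (X ω)) := by
  funext ω
  change -(Real.log (condMass μ X Y (Y ω) (X ω)) / Real.log 2) = _
  ring

/-- The bound `|log t * t| < 1` at `t = √x`, squared; the constant 4 comes from `log √x = log x /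
2`. -/
theorem mul_log_sq_le {x : ℝ} (h0 : 0 ≤ x) (h1 : x ≤ 1) : x * Real.log x ^ 2 ≤ 4 := by
  rcases h0.eq_or_lt with rfl | hx
  · simp
  have h := Real.abs_log_mul_self_lt (√x) (Real.sqrt_pos.2 hx) (Real.sqrt_le_one.2 h1)
  have h2 : (Real.log (√x) * √x) ^ 2 ≤ 1 := by
    rw [← sq_abs]; exact pow_le_one₀ (abs_nonneg _) h.le
  rw [Real.log_sqrt h0, mul_pow, Real.sq_sqrt h0] at h2
  linarith

theorem IsCondMass.integrable {α : Type*} [Fintype α] {X : Ω → α} {Y : Ω → S} {p : S → α → ℝ≥0}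
    (hY : Measurable Y) (hp : IsCondMass μ X Y p) {G : S → α → ℝ}
    (hG : ∀ x, Measurable fun y => G y x)
    (hG0 : ∀ y x, 0 ≤ G y x) (hi : Integrable (fun ω => G (Y ω) (X ω)) μ) :
    Integrable (fun ω => ∑ x, p (Y ω) x * G (Y ω) x) μ := by
  refine ⟨(Finset.measurable_sum _ fun x _ => ((hp.measurable x).comp hY).coe_nnreal_real.mul
        ((hG x).comp hY)).aestronglyMeasurable, ?_⟩
  have h := hi.2
  rw [hasFiniteIntegral_iff_ofReal (.of_forall fun ω => hG0 _ _),
    hp.lintegral_eq (fun y x => ENNReal.ofReal (G y x)) (fun x => (hG x).ennreal_ofReal)] at h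
  rw [hasFiniteIntegral_iff_ofReal
    (.of_forall fun ω => Finset.sum_nonneg fun x _ => mul_nonneg (NNReal.coe_nonneg _) (hG0 _ _))]
  refine lt_of_eq_of_lt (lintegral_congr fun ω => ?_) h
  rw [ENNReal.ofReal_sum_of_nonneg fun x _ => mul_nonneg (NNReal.coe_nonneg _) (hG0 _ _)]
  refine Finset.sum_congr rfl fun x _ => ?_
  rw [ENNReal.ofReal_mul (NNReal.coe_nonneg _), ENNReal.ofReal_coe_nnreal]

/-- The conditional second moment of the surprisal is `∑ x, p * (log p) ^ 2`, at most 4 per letter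
of the finite alphabet. -/
theorem IsCondMass.memLp_neg_log_of_le_one [IsFiniteMeasure μ] {α : Type*} [Fintype α]
    [MeasurableSpace α] [MeasurableSingletonClass α]
    {X : Ω → α} {Y : Ω → S} {p : S → α → ℝ≥0}
    (hX : Measurable X) (hY : Measurable Y) (hp : IsCondMass μ X Y p) (h1 : ∀ y x, p y x ≤ 1) :
    MemLp (fun ω => -Real.log (p (Y ω) (X ω))) 2 μ := by
  have hm : Measurable fun z : S × α => -Real.log (p z.1 z.2) :=
    measurable_from_prod_countable_left fun x =>
      (Real.measurable_log.comp (hp.measurable x).coe_nnreal_real).neg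
  have hm' : Measurable fun ω => -Real.log (p (Y ω) (X ω)) := hm.comp (hY.prodMk hX)
  rw [memLp_two_iff_integrable_sq hm'.aestronglyMeasurable]
  refine ⟨(hm'.pow_const 2).aestronglyMeasurable, ?_⟩
  rw [hasFiniteIntegral_iff_ofReal (.of_forall fun ω => sq_nonneg _),
    hp.lintegral_eq (fun y x => ENNReal.ofReal ((-Real.log (p y x)) ^ 2))
      (fun x => ((hm.comp measurable_prodMk_right).pow_const 2).ennreal_ofReal)]
  refine lt_of_le_of_lt (lintegral_mono fun ω => Finset.sum_le_sum fun x _ => ?_)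
    (b := ∫⁻ _, ∑ _ : α, ENNReal.ofReal 4 ∂μ) ?_
  · rw [← ENNReal.ofReal_coe_nnreal, ← ENNReal.ofReal_mul (NNReal.coe_nonneg _), neg_sq]
    exact ENNReal.ofReal_le_ofReal (mul_log_sq_le (NNReal.coe_nonneg _) (by exact_mod_cast h1 _ _))
  · rw [lintegral_const]
    exact ENNReal.mul_lt_top (by simp [ENNReal.mul_lt_top_iff]) (measure_lt_top _ _)

theorem memLp_condEntropyRV [IsFiniteMeasure μ] {X : Ω → ZMod 2} {Y : Ω → S}
    (hX : Measurable X) (hY : Measurable Y) : MemLp (condEntropyRV μ X Y) 2 μ := by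
  rw [condEntropyRV_eq_condMass]
  exact ((isCondMass_condMass hX hY).memLp_neg_log_of_le_one hX hY
    (condMass_le_one μ X Y)).const_mul _

theorem IsCondMass.varentropy_eq [IsFiniteMeasure μ] {X : Ω → ZMod 2} {Y : Ω → S}
    {p : S → ZMod 2 → ℝ≥0} (hX : Measurable X) (hY : Measurable Y) (hp : IsCondMass μ X Y p) :
    varentropy μ X Y
      = ((Real.log 2)⁻¹) ^ 2 * variance (fun ω => -Real.log (p (Y ω) (X ω))) μ := by
  rw [varentropy, condEntropyRV_eq_condMass, variance_const_mul]
  congr 1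
  refine variance_congr ?_
  filter_upwards [(isCondMass_condMass hX hY).ae_eq hY hp] with ω hω
  rw [hω]

/-- The varentropy depends on the side information only through the generated `σ`-algebra. -/
theorem varentropy_congr_comap [IsFiniteMeasure μ] {T : Type*} [mT : MeasurableSpace T]
    {X : Ω → ZMod 2} {Y : Ω → S} {Z : Ω → T}
    (hX : Measurable X) (hY : Measurable Y) (hZ : Measurable Z)
    (hYZ : Measurable[mT.comap Z] Y) (hZY : Measurable[mS.comap Y] Z) :
    varentropy μ X Y = varentropy μ X Z := by
  have hc : mS.comap Y = mT.comap Z :=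
    le_antisymm (measurable_iff_comap_le.1 hYZ) (measurable_iff_comap_le.1 hZY)
  refine variance_congr ?_
  have h : ∀ x, ∀ᵐ ω ∂μ,
      (condDistrib X Y μ (Y ω)).real {x} = (condDistrib X Z μ (Z ω)).real {x} := by
    intro x
    -- Both conditional masses are versions of the conditional expectation of the indicator of `X =
    -- x` given the same σ-algebra.
    have h1 := condDistrib_ae_eq_condExp (μ := μ) hY hX (measurableSet_singleton x)
    have h2 := condDistrib_ae_eq_condExp (μ := μ) hZ hX (measurableSet_singleton x)
    rw [hc] at h1
    exact h1.trans h2.symm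
  filter_upwards [ae_all_iff.2 h] with ω hω
  rw [condEntropyRV, condEntropyRV, hω]

end EntropyRV

/-! ### The pair step -/

section Pair

variable {Ω S T : Type*} [MeasurableSpace Ω] [MeasurableSpace S] [MeasurableSpace T]
  {μ : Measure Ω} [IsProbabilityMeasure μ]
  {X₁ X₂ : Ω → ZMod 2} {Y₁ : Ω → S} {Y₂ : Ω → T}

/-- With `a` and `b` the biases of the two bits, the two integrands are the conditional mean
surprisals of the outputs. Both decrease in each bias, so Harris' inequality applies under the
product law of `(Y₁, Y₂)`. -/
theorem integral_polar_entropy_mul_le {a : S → ℝ} {b : T → ℝ} (ha : Measurable a)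
    (hb : Measurable b) (ha0 : ∀ y, 0 ≤ a y) (ha1 : ∀ y, a y ≤ 1) (hb0 : ∀ y, 0 ≤ b y)
    (hb1 : ∀ y, b y ≤ 1) (hY₁ : Measurable Y₁) (hY₂ : Measurable Y₂) (hind : IndepFun Y₁ Y₂ μ) :
    Integrable (fun ω => biasEntropy (a (Y₁ ω) * b (Y₂ ω)) * (biasEntropy (a (Y₁ ω))
      + biasEntropy (b (Y₂ ω)) - biasEntropy (a (Y₁ ω) * b (Y₂ ω)))) μ ∧
    (∫ ω, biasEntropy (a (Y₁ ω) * b (Y₂ ω)) ∂μ) *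
      ∫ ω, (biasEntropy (a (Y₁ ω)) + biasEntropy (b (Y₂ ω))
        - biasEntropy (a (Y₁ ω) * b (Y₂ ω))) ∂μ ≤
    ∫ ω, biasEntropy (a (Y₁ ω) * b (Y₂ ω)) * (biasEntropy (a (Y₁ ω)) + biasEntropy (b (Y₂ ω))
        - biasEntropy (a (Y₁ ω) * b (Y₂ ω))) ∂μ := by
  set f : S × T → ℝ := fun z => biasEntropy (a z.1 * b z.2) with hf
  set g : S × T → ℝ := fun z => biasEntropy (a z.1) + biasEntropy (b z.2) - f z with hg
  have hm := continuous_biasEntropy.measurable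
  have hfm : Measurable f :=
    hm.comp ((ha.comp measurable_fst).mul (hb.comp measurable_snd))
  have hgm : Measurable g :=
    ((hm.comp (ha.comp measurable_fst)).add (hm.comp (hb.comp measurable_snd))).sub hfm
  have hab0 : ∀ x y, 0 ≤ a x * b y := fun x y => mul_nonneg (ha0 x) (hb0 y)
  have hab1 : ∀ x y, a x * b y ≤ 1 := fun x y => mul_le_one₀ (ha1 x) (hb0 y) (hb1 y)
  have hl2 : 0 < Real.log 2 := Real.log_pos one_lt_two
  have hfC : ∀ z, |f z| ≤ 2 * Real.log 2 := fun z => by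
    have h0 := biasEntropy_nonneg (hab0 z.1 z.2) (hab1 z.1 z.2)
    have h1 := biasEntropy_le (a z.1 * b z.2)
    rw [abs_le]; constructor <;> linarith
  have hgC : ∀ z, |g z| ≤ 2 * Real.log 2 := fun z => by
    have h0 := biasEntropy_nonneg (hab0 z.1 z.2) (hab1 z.1 z.2)
    have h1 := biasEntropy_le (a z.1 * b z.2)
    have h2 := biasEntropy_nonneg (ha0 z.1) (ha1 z.1)
    have h3 := biasEntropy_le (a z.1)
    have h4 := biasEntropy_nonneg (hb0 z.2) (hb1 z.2)
    have h5 := biasEntropy_le (b z.2)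
    simp only [hg, hf]
    rw [abs_le]; constructor <;> linarith
  have mono₁ : ∀ y x x', a x ≤ a x' → f (x', y) ≤ f (x, y) ∧ g (x', y) ≤ g (x, y) := by
    intro y x x' h
    refine ⟨biasEntropy_antitoneOn ⟨hab0 _ _, hab1 _ _⟩ ⟨hab0 _ _, hab1 _ _⟩
      (mul_le_mul_of_nonneg_right h (hb0 y)), ?_⟩
    have := biasEntropy_sub_le (hb0 y) (hb1 y) (ha0 x) h (ha1 x')
    simp only [hg, hf, mul_comm (a _)]
    linarith
  have mono₂ : ∀ x y y', b y ≤ b y' → f (x, y') ≤ f (x, y) ∧ g (x, y') ≤ g (x, y) := by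
    intro x y y' h
    refine ⟨biasEntropy_antitoneOn ⟨hab0 _ _, hab1 _ _⟩ ⟨hab0 _ _, hab1 _ _⟩
      (mul_le_mul_of_nonneg_left h (ha0 x)), ?_⟩
    have := biasEntropy_sub_le (ha0 x) (ha1 x) (hb0 y) h (hb1 y')
    simp only [hg, hf]
    linarith
  have : IsProbabilityMeasure (μ.map Y₁) := Measure.isProbabilityMeasure_map hY₁.aemeasurable
  have : IsProbabilityMeasure (μ.map Y₂) := Measure.isProbabilityMeasure_map hY₂.aemeasurable
  have key := integral_mul_integral_le_integral_mul_prod (ν₁ := μ.map Y₁) (ν₂ := μ.map Y₂)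
    hfm hgm hfC hgC
    (fun y x x' => by
      rcases le_total (a x) (a x') with h | h
      · have := mono₁ y x x' h
        exact mul_nonneg (sub_nonneg.2 this.1) (sub_nonneg.2 this.2)
      · have := mono₁ y x' x h
        exact mul_nonneg_of_nonpos_of_nonpos (sub_nonpos.2 this.1) (sub_nonpos.2 this.2))
    (fun y y' => (le_total (b y) (b y')).symm.imp (fun h x => mono₂ x y' y h)
      (fun h x => mono₂ x y y' h))
  rw [← (indepFun_iff_map_prod_eq_prod_map_map hY₁.aemeasurable hY₂.aemeasurable).1 hind] at key
  have hYm : AEMeasurable (fun ω => (Y₁ ω, Y₂ ω)) μ := (hY₁.prodMk hY₂).aemeasurable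
  rw [integral_map hYm hfm.aestronglyMeasurable, integral_map hYm hgm.aestronglyMeasurable,
    integral_map (f := fun z => f z * g z) hYm (hfm.mul hgm).aestronglyMeasurable] at key
  refine ⟨.of_bound ((hfm.mul hgm).comp (hY₁.prodMk hY₂)).aestronglyMeasurable
    (2 * Real.log 2 * (2 * Real.log 2)) (.of_forall fun ω => ?_), key⟩
  rw [Real.norm_eq_abs, abs_mul]
  exact mul_le_mul (hfC (Y₁ ω, Y₂ ω)) (hgC (Y₁ ω, Y₂ ω)) (abs_nonneg _) (by positivity)

/-- One step of the polar transform does not increase the sum of the varentropies. -/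
theorem varentropy_add_le (hX₁ : Measurable X₁) (hX₂ : Measurable X₂) (hY₁ : Measurable Y₁)
    (hY₂ : Measurable Y₂)
    (hind : IndepFun (fun ω => (X₁ ω, Y₁ ω)) (fun ω => (X₂ ω, Y₂ ω)) μ) :
    varentropy μ (fun ω => X₁ ω + X₂ ω) (fun ω => (Y₁ ω, Y₂ ω))
      + varentropy μ X₂ (fun ω => (X₁ ω + X₂ ω, (Y₁ ω, Y₂ ω)))
      ≤ varentropy μ X₁ Y₁ + varentropy μ X₂ Y₂ := by
  set p := condMass μ X₁ Y₁ with hp_def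
  set q := condMass μ X₂ Y₂ with hq_def
  have hp : IsCondMass μ X₁ Y₁ p := isCondMass_condMass hX₁ hY₁
  have hq : IsCondMass μ X₂ Y₂ q := isCondMass_condMass hX₂ hY₂
  have hp1 : ∀ y, (p y 0 : ℝ) + p y 1 = 1 := fun y => by exact_mod_cast condMass_add μ X₁ Y₁ y
  have hq1 : ∀ y, (q y 0 : ℝ) + q y 1 = 1 := fun y => by exact_mod_cast condMass_add μ X₂ Y₂ y
  let e : ZMod 2 × ZMod 2 ≃ ZMod 2 × ZMod 2 :=
    { toFun := fun x => (x.1 + x.2, x.2)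
      invFun := fun u => (u.1 + u.2, u.2)
      left_inv := by decide
      right_inv := by decide }
  -- `R` is the conditional mass of the output pair and `r` that of the first output; over the
  -- two-element field the inputs are recovered as `(u₁ + u₂, u₂)`.
  set R : S × T → ZMod 2 × ZMod 2 → ℝ≥0 := fun y w => p y.1 (w.1 + w.2) * q y.2 w.2 with hR_def
  set r : S × T → ZMod 2 → ℝ≥0 := fun y u => ∑ v, R y (u, v) with hr_def
  have hU₁ : Measurable fun ω => X₁ ω + X₂ ω := hX₁.add hX₂
  have hY : Measurable fun ω => (Y₁ ω, Y₂ ω) := hY₁.prodMk hY₂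
  have hUY : Measurable fun ω => (X₁ ω + X₂ ω, (Y₁ ω, Y₂ ω)) := hU₁.prodMk hY
  have hR : IsCondMass μ (fun ω => (X₁ ω + X₂ ω, X₂ ω)) (fun ω => (Y₁ ω, Y₂ ω)) R :=
    (hp.prod hX₁ hX₂ hY₁ hY₂ hind hq).map_equiv e
  have hr : IsCondMass μ (fun ω => X₁ ω + X₂ ω) (fun ω => (Y₁ ω, Y₂ ω)) r := hR.fst
  have hs := hR.snd_given_fst
  have hr0 : ∀ y, (r y 0 : ℝ) = p y.1 0 * q y.2 0 + p y.1 1 * q y.2 1 := fun y => by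
    simp [hr_def, hR_def, sum_zmod_two]
  have h11 : (1 + 1 : ZMod 2) = 0 := by decide
  have hr1 : ∀ y, (r y 1 : ℝ) = p y.1 1 * q y.2 0 + p y.1 0 * q y.2 1 := fun y => by
    simp [hr_def, hR_def, sum_zmod_two, h11]
  have hr_add : ∀ y, (r y 0 : ℝ) + r y 1 = 1 := fun y => by
    rw [hr0, hr1]; linear_combination ((q y.2 0 : ℝ) + q y.2 1) * hp1 y.1 + hq1 y.2
  have hr_le : ∀ y u, r y u ≤ 1 := fun y u => by
    have h0 := NNReal.coe_nonneg (r y 0)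
    have h1 := NNReal.coe_nonneg (r y 1)
    have h : r y 0 ≤ 1 ∧ r y 1 ≤ 1 := by
      constructor <;> rw [← NNReal.coe_le_coe, NNReal.coe_one] <;> linarith [hr_add y]
    revert u
    exact Fin.forall_fin_two.2 h
  have hs_le : ∀ y u v, R y (u, v) / r y u ≤ 1 := fun y u v =>
    div_le_one_of_le₀ (Finset.single_le_sum (f := fun v => R y (u, v)) (fun _ _ => zero_le)
      (Finset.mem_univ v)) zero_le
  set A : Ω → ℝ := fun ω => -Real.log (r (Y₁ ω, Y₂ ω) (X₁ ω + X₂ ω)) with hA_def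
  set B : Ω → ℝ := fun ω => -Real.log ((R (Y₁ ω, Y₂ ω) (X₁ ω + X₂ ω, X₂ ω) /
    r (Y₁ ω, Y₂ ω) (X₁ ω + X₂ ω) : ℝ≥0)) with hB_def
  have hA : MemLp A 2 μ := hr.memLp_neg_log_of_le_one hU₁ hY hr_le
  have hB : MemLp B 2 μ := hs.memLp_neg_log_of_le_one (X := X₂)
    (Y := fun ω => (X₁ ω + X₂ ω, (Y₁ ω, Y₂ ω)))
    hX₂ hUY fun y v => hs_le y.2 y.1 v
  have hC₁ := hp.memLp_neg_log_of_le_one hX₁ hY₁ (condMass_le_one μ X₁ Y₁)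
  have hC₂ := hq.memLp_neg_log_of_le_one hX₂ hY₂ (condMass_le_one μ X₂ Y₂)
  rw [hr.varentropy_eq hU₁ hY, hs.varentropy_eq hX₂ hUY, hp.varentropy_eq hX₁ hY₁,
    hq.varentropy_eq hX₂ hY₂, ← mul_add, ← mul_add]
  refine mul_le_mul_of_nonneg_left ?_ (sq_nonneg _)
  change variance A μ + variance B μ ≤ _
  have hmp : Measurable fun z : ZMod 2 × S => -Real.log (p z.2 z.1) :=
    measurable_from_prod_countable_right fun x =>
      (Real.measurable_log.comp (hp.measurable x).coe_nnreal_real).neg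
  have hmq : Measurable fun z : ZMod 2 × T => -Real.log (q z.2 z.1) :=
    measurable_from_prod_countable_right fun x =>
      (Real.measurable_log.comp (hq.measurable x).coe_nnreal_real).neg
  -- Since `R` factors as `p * q`, the factor `r` cancels in `A + B`, leaving the sum of the
  -- independent input surprisals.
  have hsum : variance (A + B) μ = variance (fun ω => -Real.log (p (Y₁ ω) (X₁ ω))) μ
      + variance (fun ω => -Real.log (q (Y₂ ω) (X₂ ω))) μ := by
    rw [← IndepFun.variance_add hC₁ hC₂ (hind.comp hmp hmq)]
    refine variance_congr ?_
    filter_upwards [hR.ae_pos (hU₁.prodMk hX₂) hY] with ω hω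
    have hx : X₁ ω + X₂ ω + X₂ ω = X₁ ω := by
      rw [add_assoc, CharTwo.add_self_eq_zero, add_zero]
    have hR' : R (Y₁ ω, Y₂ ω) (X₁ ω + X₂ ω, X₂ ω) = p (Y₁ ω) (X₁ ω) * q (Y₂ ω) (X₂ ω) := by
      simp only [hR_def, hx]
    have hr' : r (Y₁ ω, Y₂ ω) (X₁ ω + X₂ ω) ≠ 0 := fun h =>
      hω ((Finset.sum_eq_zero_iff.1 h) _ (Finset.mem_univ _))
    simp only [Pi.add_apply, hA_def, hB_def]
    rw [NNReal.coe_div, Real.log_div (NNReal.coe_ne_zero.2 hω) (NNReal.coe_ne_zero.2 hr')]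
    rw [hR'] at hω ⊢
    rw [NNReal.coe_mul, Real.log_mul (NNReal.coe_ne_zero.2 (left_ne_zero_of_mul hω))
      (NNReal.coe_ne_zero.2 (right_ne_zero_of_mul hω))]
    ring
  rw [← hsum, variance_add hA hB]
  suffices hcov : 0 ≤ covariance A B μ by linarith
  rw [covariance_eq_sub hA hB, sub_nonneg]
  set a : S → ℝ := fun y => |1 - 2 * (p y 1 : ℝ)| with ha_def
  set b : T → ℝ := fun y => |1 - 2 * (q y 1 : ℝ)| with hb_def
  have ha : Measurable a := by
    have := (hp.measurable 1).coe_nnreal_real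
    exact (measurable_const.sub (this.const_mul 2)).abs
  have hb : Measurable b := by
    have := (hq.measurable 1).coe_nnreal_real
    exact (measurable_const.sub (this.const_mul 2)).abs
  have ha1 : ∀ y, a y ≤ 1 := fun y => abs_le.2 <| by
    constructor <;> linarith [hp1 y, NNReal.coe_nonneg (p y 0), NNReal.coe_nonneg (p y 1)]
  have hb1 : ∀ y, b y ≤ 1 := fun y => abs_le.2 <| by
    constructor <;> linarith [hq1 y, NNReal.coe_nonneg (q y 0), NNReal.coe_nonneg (q y 1)]
  obtain ⟨hint, hharris⟩ := integral_polar_entropy_mul_le ha hb (fun _ => abs_nonneg _) ha1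
    (fun _ => abs_nonneg _) hb1 hY₁ hY₂ (hind.comp measurable_snd measurable_snd)
  -- Biases multiply under addition of independent bits: `1 - 2 r₁ = (1 - 2 p₁) (1 - 2 q₁)`.
  have hab : ∀ y : S × T, biasEntropy (a y.1 * b y.2) = Real.binEntropy (r y 1) := fun y => by
    rw [← biasEntropy_abs, ha_def, hb_def, ← abs_mul]
    congr 2
    rw [hr1]
    linear_combination (2 * (q y.2 1 : ℝ)) * hp1 y.1 + (2 * (p y.1 1 : ℝ)) * hq1 y.2
  have hlog : ∀ x : ℝ≥0, x ≤ 1 → 0 ≤ -Real.log x := fun x hx =>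
    neg_nonneg.2 (Real.log_nonpos x.2 (by exact_mod_cast hx))
  have hmr : ∀ u, Measurable fun y => -Real.log (r y u) := fun u =>
    (Real.measurable_log.comp (hr.measurable u).coe_nnreal_real).neg
  have hms : ∀ w : ZMod 2 × ZMod 2, Measurable fun y => -Real.log ((R y w / r y w.1 : ℝ≥0)) :=
    fun w => (Real.measurable_log.comp
      ((hR.measurable w).div (hr.measurable w.1)).coe_nnreal_real).neg
  have hfA : ∀ y, ∑ u, (r y u : ℝ) * -Real.log (r y u) = biasEntropy (a y.1 * b y.2) := by
    intro y
    rw [hab, sum_zmod_two, Real.binEntropy_eq_negMulLog_add_negMulLog_one_sub, ← hr_add y,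
      add_sub_cancel_right, Real.negMulLog, Real.negMulLog]
    ring
  have hfB : ∀ y, ∑ w, (R y w : ℝ) * -Real.log ((R y w / r y w.1 : ℝ≥0))
      = biasEntropy (a y.1) + biasEntropy (b y.2) - biasEntropy (a y.1 * b y.2) := by
    intro y
    rw [hab, hr1]
    simp only [ha_def, hb_def, biasEntropy_abs]
    rw [← cond_entropy_add_eq (NNReal.coe_nonneg _) (NNReal.coe_nonneg _) (NNReal.coe_nonneg _)
      (NNReal.coe_nonneg _) (hp1 y.1) (hq1 y.2)]
    simp only [Fintype.sum_prod_type, sum_zmod_two, NNReal.coe_div, hr0, hr1]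
    simp only [hR_def, NNReal.coe_mul, add_zero, zero_add, h11]
  -- Nonnegative conditional covariance given `y`: the product of the conditional means is at most
  -- the conditional mean of `A * B`.
  have hfAB : ∀ y, biasEntropy (a y.1 * b y.2) * (biasEntropy (a y.1) + biasEntropy (b y.2)
      - biasEntropy (a y.1 * b y.2)) ≤
      ∑ w, (R y w : ℝ) * (-Real.log (r y w.1) * -Real.log ((R y w / r y w.1 : ℝ≥0))) := by
    intro y
    rw [← hfB, ← hfA]
    have h := polar_entropy_mul_le (NNReal.coe_nonneg _) (NNReal.coe_nonneg _)
      (NNReal.coe_nonneg _) (NNReal.coe_nonneg _) (hp1 y.1) (hq1 y.2)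
    simp only [Fintype.sum_prod_type, sum_zmod_two, NNReal.coe_div, hr0, hr1]
    simp only [hR_def, NNReal.coe_mul, add_zero, zero_add, h11]
    refine h.trans (le_of_eq ?_)
    ring
  have eA : ∫ ω, A ω ∂μ = ∫ ω, biasEntropy (a (Y₁ ω) * b (Y₂ ω)) ∂μ := by
    rw [hr.integral_eq hU₁ hY (G := fun y u => -Real.log (r y u)) hmr
      (fun y u => hlog _ (hr_le y u))]
    exact integral_congr_ae (.of_forall fun ω => hfA _)
  have eB : ∫ ω, B ω ∂μ = ∫ ω, (biasEntropy (a (Y₁ ω)) + biasEntropy (b (Y₂ ω))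
        - biasEntropy (a (Y₁ ω) * b (Y₂ ω))) ∂μ := by
    rw [hR.integral_eq (hU₁.prodMk hX₂) hY (G := fun y w => -Real.log ((R y w / r y w.1 : ℝ≥0)))
      hms (fun y w => hlog _ (hs_le y w.1 w.2))]
    exact integral_congr_ae (.of_forall fun ω => hfB _)
  have hG : ∀ w : ZMod 2 × ZMod 2, Measurable fun y =>
      -Real.log (r y w.1) * -Real.log ((R y w / r y w.1 : ℝ≥0)) := fun w => (hmr w.1).mul (hms w)
  have hG0 : ∀ y (w : ZMod 2 × ZMod 2),
      0 ≤ -Real.log (r y w.1) * -Real.log ((R y w / r y w.1 : ℝ≥0)) := fun y w =>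
    mul_nonneg (hlog _ (hr_le y w.1)) (hlog _ (hs_le y w.1 w.2))
  have hAB : Integrable (fun ω => A ω * B ω) μ := hA.integrable_mul hB
  rw [eA, eB]
  refine hharris.trans ?_
  change _ ≤ ∫ ω, A ω * B ω ∂μ
  rw [hR.integral_eq (hU₁.prodMk hX₂) hY hG hG0]
  exact integral_mono hint (hR.integrable hY hG hG0 hAB) fun ω => hfAB (Y₁ ω, Y₂ ω)

end Pair

/-! ### Recursive structure of the polar transform -/

section PolarTransform

theorem measurable_zmod_two_add {Ω : Type*} {m : MeasurableSpace Ω} {f g : Ω → ZMod 2}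
    (hf : Measurable f) (hg : Measurable g) : Measurable fun ω => f ω + g ω :=
  (measurable_of_countable fun p : ZMod 2 × ZMod 2 => p.1 + p.2).comp (hf.prodMk hg)

variable {Ω : Type*} {n : ℕ}

/-- The order fixes the past of each output: an index in the lower half sees only the lower half,
while one in the upper half sees the whole lower half. -/
theorem kroneckerIndexEquiv_lt_iff {a a' : Fin 2} {c c' : Fin (2 ^ n)} :
    kroneckerIndexEquiv 2 n (a, c) < kroneckerIndexEquiv 2 n (a', c') ↔
      a < a' ∨ a = a' ∧ c < c' := by
  have h : ∀ (a : Fin 2) (c : Fin (2 ^ n)),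
      (kroneckerIndexEquiv 2 n (a, c) : ℕ) = c + 2 ^ n * a := fun _ _ => rfl
  rw [Fin.lt_def, h, h]
  have := c.2
  have := c'.2
  fin_cases a <;> fin_cases a' <;> simp <;> omega

theorem sum_kroneckerIndexEquiv {M : Type*} [AddCommMonoid M] (f : Fin (2 ^ (n + 1)) → M) :
    ∑ i, f i =
      ∑ d, f (kroneckerIndexEquiv 2 n (0, d)) + ∑ d, f (kroneckerIndexEquiv 2 n (1, d)) := by
  rw [← (kroneckerIndexEquiv 2 n).sum_comp, Fintype.sum_prod_type, Fin.sum_univ_two]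

/-- Applied to `F * F = 1`, this makes the transform an involution, so the whole lower half of the
outputs determines the sums `X (0, c) + X (1, c)`. -/
theorem kroneckerPow_mul_self {R : Type*} [CommSemiring R] {m : ℕ} {A : Matrix (Fin m) (Fin m) R}
    (hA : A * A = 1) : ∀ n, kroneckerPow A n * kroneckerPow A n = 1
  | 0 => one_mul 1
  | n + 1 => by
    rw [kroneckerPow, Matrix.reindex_apply, Matrix.submatrix_mul_equiv, Matrix.kronecker,
      ← Matrix.mul_kronecker_mul, hA, kroneckerPow_mul_self hA n, Matrix.one_kronecker_one,
      Matrix.submatrix_one_equiv]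

theorem polarTransform_zero (X : Fin (2 ^ 0) → Ω → ZMod 2) : polarTransform 0 X = X := by
  funext i ω
  simp [polarTransform, kroneckerPow]

theorem polarTransform_polarTransform (X : Fin (2 ^ n) → Ω → ZMod 2) :
    polarTransform n (polarTransform n X) = X := by
  funext i ω
  change Matrix.vecMul (Matrix.vecMul (fun j => X j ω) (kroneckerPow polarKernel n))
    (kroneckerPow polarKernel n) i = X i ω
  rw [Matrix.vecMul_vecMul, kroneckerPow_mul_self (by decide), Matrix.vecMul_one]

theorem polarTransform_succ (X : Fin (2 ^ (n + 1)) → Ω → ZMod 2) (b : Fin 2) (d : Fin (2 ^ n)) :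
    polarTransform (n + 1) X (kroneckerIndexEquiv 2 n (b, d)) = polarTransform n
      (fun c ω => ∑ a, X (kroneckerIndexEquiv 2 n (a, c)) ω * polarKernel a b) d := by
  funext ω
  simp only [polarTransform, Matrix.vecMul, dotProduct]
  rw [← (kroneckerIndexEquiv 2 n).sum_comp, Fintype.sum_prod_type_right]
  refine Finset.sum_congr rfl fun c _ => ?_
  rw [Finset.sum_mul]
  refine Finset.sum_congr rfl fun a _ => ?_
  simp [kroneckerPow, Matrix.kroneckerMap_apply, mul_assoc]

theorem polarTransform_succ_zero (X : Fin (2 ^ (n + 1)) → Ω → ZMod 2) (d : Fin (2 ^ n)) :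
    polarTransform (n + 1) X (kroneckerIndexEquiv 2 n (0, d)) = polarTransform n
      (fun c ω => X (kroneckerIndexEquiv 2 n (0, c)) ω
        + X (kroneckerIndexEquiv 2 n (1, c)) ω) d := by
  simp [polarTransform_succ, polarKernel]

theorem polarTransform_succ_one (X : Fin (2 ^ (n + 1)) → Ω → ZMod 2) (d : Fin (2 ^ n)) :
    polarTransform (n + 1) X (kroneckerIndexEquiv 2 n (1, d)) = polarTransform n
      (fun c => X (kroneckerIndexEquiv 2 n (1, c))) d := by
  simp [polarTransform_succ, polarKernel]

theorem measurable_polarTransform {m : MeasurableSpace Ω} {X : Fin (2 ^ n) → Ω → ZMod 2}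
    (hX : ∀ i, Measurable (X i)) (i : Fin (2 ^ n)) : Measurable (polarTransform n X i) :=
  (measurable_of_countable fun x => Matrix.vecMul x (kroneckerPow polarKernel n) i).comp
    (measurable_pi_lambda _ hX)

variable {S : Fin (2 ^ n) → Type*} [∀ i, MeasurableSpace (S i)]
  {X : Fin (2 ^ n) → Ω → ZMod 2} {Y : (i : Fin (2 ^ n)) → Ω → S i}

theorem measurable_polarSideInfo {m : MeasurableSpace Ω} {i : Fin (2 ^ n)}
    (hU : ∀ j < i, Measurable (polarTransform n X j)) (hY : ∀ j, Measurable (Y j)) :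
    Measurable (polarSideInfo X Y i) := by
  refine Measurable.prodMk ?_ (measurable_pi_lambda _ hY)
  rw [measurable_pi_iff]
  rintro ⟨j, hj⟩
  exact hU j hj

theorem measurable_comap_polarSideInfo_transform {i j : Fin (2 ^ n)} (hj : j < i) :
    Measurable[MeasurableSpace.comap (polarSideInfo X Y i) inferInstance]
      (polarTransform n X j) :=
  ((measurable_pi_apply (⟨j, hj⟩ : Set.Iio i)).comp measurable_fst).comp
    (comap_measurable (polarSideInfo X Y i))

theorem measurable_comap_polarSideInfo_right (i j : Fin (2 ^ n)) :
    Measurable[MeasurableSpace.comap (polarSideInfo X Y i) inferInstance] (Y j) :=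
  ((measurable_pi_apply j).comp measurable_snd).comp (comap_measurable (polarSideInfo X Y i))

end PolarTransform

/-! ### Independence of disjoint blocks -/

namespace ProbabilityTheory

/-- Independence says that the joint law is a product measure, and currying a product over a sigma
type gives a product of products. -/
theorem iIndepFun.curry {Ω ι : Type*} {κ : ι → Type*} {E : (i : ι) → κ i → Type*}
    {mΩ : MeasurableSpace Ω} {P : Measure Ω} {mE : ∀ i j, MeasurableSpace (E i j)}
    {X : (i : ι) → (j : κ i) → Ω → E i j}
    (mX : ∀ i j, Measurable (X i j))
    (h : iIndepFun (fun (p : (i : ι) × κ i) ω => X p.1 p.2 ω) P) :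
    iIndepFun (fun i ω j => X i j ω) P := by
  have := h.isProbabilityMeasure
  have : ∀ i j, IsProbabilityMeasure (P.map (X i j)) :=
    fun i j => Measure.isProbabilityMeasure_map (mX i j).aemeasurable
  have : ∀ i, IsProbabilityMeasure (P.map (fun ω j => X i j ω)) :=
    fun i => Measure.isProbabilityMeasure_map (Measurable.aemeasurable (by fun_prop))
  have hi : ∀ i, iIndepFun (X i) P := fun i =>
    h.precomp (g := fun j => (⟨i, j⟩ : (i : ι) × κ i)) sigma_mk_injective
  have e : (MeasurableEquiv.piCurry E) ∘ (fun ω p => X p.1 p.2 ω) = fun ω i j => X i j ω := by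
    ext; simp [Sigma.curry]
  rw [iIndepFun_iff_map_fun_eq_infinitePi_map (by fun_prop)] at h ⊢
  rw [← e, ← Measure.map_map (by fun_prop) (by fun_prop), h,
    Measure.infinitePi_map_piCurry (fun i j => P.map (X i j))]
  congrm Measure.infinitePi fun i => ?_
  rw [(iIndepFun_iff_map_fun_eq_infinitePi_map (by fun_prop)).1 (hi i)]

end ProbabilityTheory

/-! ### Induction on the number of levels -/

/-- The polar transform of independent binary data elements does not increase the sum of the
varentropies. -/
theorem sum_varentropy_polarTransform_le (n : ℕ) {Ω : Type*} [MeasurableSpace Ω]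
    (μ : Measure Ω) [IsProbabilityMeasure μ]
    {S : Fin (2 ^ n) → Type*} [∀ i, MeasurableSpace (S i)]
    (X : Fin (2 ^ n) → Ω → ZMod 2) (Y : (i : Fin (2 ^ n)) → Ω → S i)
    (hX : ∀ i, Measurable (X i)) (hY : ∀ i, Measurable (Y i))
    (hindep : iIndepFun (fun i ω => (X i ω, Y i ω)) μ) :
    ∑ i, varentropy μ (polarTransform n X i) (polarSideInfo X Y i) ≤
      ∑ i, varentropy μ (X i) (Y i) := by
  induction n with
  | zero =>
    -- With one input the past is empty, so the side information generates the same σ-algebra as `Y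
    -- i`.
    refine Finset.sum_le_sum fun i _ => le_of_eq ?_
    rw [polarTransform_zero]
    refine varentropy_congr_comap (hX i)
      (measurable_polarSideInfo (fun j _ => measurable_polarTransform hX j) hY) (hY i) ?_
      (measurable_comap_polarSideInfo_right i i)
    have hsub : ∀ j : Fin (2 ^ 0), j = i := fun j =>
      (Fin.subsingleton_one : Subsingleton (Fin 1)).elim j i
    refine measurable_polarSideInfo (fun j hj => absurd (hsub j) hj.ne) fun j => ?_
    rw [hsub j]
    exact comap_measurable _
  | succ n ih =>
    set e := kroneckerIndexEquiv 2 n with he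
    let Xp : Fin (2 ^ n) → Ω → ZMod 2 := fun c ω => X (e (0, c)) ω + X (e (1, c)) ω
    let Xm : Fin (2 ^ n) → Ω → ZMod 2 := fun c => X (e (1, c))
    let Yp : (c : Fin (2 ^ n)) → Ω → S (e (0, c)) × S (e (1, c)) := fun c ω =>
      (Y (e (0, c)) ω, Y (e (1, c)) ω)
    -- The sum bit joins the side information of the second bit, so the induction must allow the
    -- alphabets to vary.
    let Ym : (c : Fin (2 ^ n)) → Ω → ZMod 2 × (S (e (0, c)) × S (e (1, c))) := fun c ω =>
      (Xp c ω, Yp c ω)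
    have hXp : ∀ c, Measurable (Xp c) := fun c => (hX _).add (hX _)
    have hXm : ∀ c, Measurable (Xm c) := fun c => hX _
    have hYp : ∀ c, Measurable (Yp c) := fun c => (hY _).prodMk (hY _)
    have hYm : ∀ c, Measurable (Ym c) := fun c => (hXp c).prodMk (hYp c)
    have hU := measurable_polarTransform hX
    have hblock : iIndepFun (fun (c : Fin (2 ^ n)) ω (a : Fin 2) =>
        (X (e (a, c)) ω, Y (e (a, c)) ω)) μ := by
      refine iIndepFun.curry (κ := fun _ => Fin 2)
        (X := fun c a ω => (X (e (a, c)) ω, Y (e (a, c)) ω))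
        (fun c a => (hX _).prodMk (hY _)) ?_
      refine hindep.precomp (g := fun p : (_ : Fin (2 ^ n)) × Fin 2 => e (p.2, p.1)) ?_
      rintro ⟨c, a⟩ ⟨c', a'⟩ h
      have := e.injective h
      simp_all
    have hip : iIndepFun (fun c ω => (Xp c ω, Yp c ω)) μ :=
      hblock.comp (fun c z => ((z 0).1 + (z 1).1, ((z 0).2, (z 1).2)))
        (fun c => by
          refine Measurable.prodMk (measurable_zmod_two_add ?_ ?_)
            (Measurable.prodMk ?_ ?_) <;> fun_prop)
    have him : iIndepFun (fun c ω => (Xm c ω, Ym c ω)) μ :=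
      hblock.comp (fun c z => ((z 1).1, ((z 0).1 + (z 1).1, ((z 0).2, (z 1).2))))
        (fun c => by
          refine Measurable.prodMk ?_ (Measurable.prodMk (measurable_zmod_two_add ?_ ?_)
            (Measurable.prodMk ?_ ?_)) <;> fun_prop)
    have hlow : ∀ d, varentropy μ (polarTransform (n + 1) X (e (0, d)))
        (polarSideInfo X Y (e (0, d)))
        = varentropy μ (polarTransform n Xp d) (polarSideInfo Xp Yp d) := by
      intro d
      rw [polarTransform_succ_zero]
      refine varentropy_congr_comap (measurable_polarTransform hXp d)
        (measurable_polarSideInfo (fun j _ => hU j) hY)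
        (measurable_polarSideInfo (fun j _ => measurable_polarTransform hXp j) hYp) ?_ ?_
      · refine measurable_polarSideInfo (fun j hj => ?_) fun j => ?_
        · obtain ⟨⟨a, c⟩, rfl⟩ := e.surjective j
          obtain ⟨rfl, hc⟩ : a = 0 ∧ c < d := by
            rcases kroneckerIndexEquiv_lt_iff.1 hj with h | h
            · exact absurd h (Fin.not_lt_zero a)
            · exact h
          rw [polarTransform_succ_zero]
          exact measurable_comap_polarSideInfo_transform hc
        · obtain ⟨⟨a, c⟩, rfl⟩ := e.surjective j
          have h := measurable_comap_polarSideInfo_right (X := Xp) (Y := Yp) d c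
          revert a
          exact Fin.forall_fin_two.2 ⟨measurable_fst.comp h, measurable_snd.comp h⟩
      · refine measurable_polarSideInfo (fun c hc => ?_) fun c => ?_
        · rw [← polarTransform_succ_zero]
          exact measurable_comap_polarSideInfo_transform
            (kroneckerIndexEquiv_lt_iff.2 (Or.inr ⟨rfl, hc⟩))
        · exact (measurable_comap_polarSideInfo_right _ _).prodMk
            (measurable_comap_polarSideInfo_right _ _)
    have hhigh : ∀ d, varentropy μ (polarTransform (n + 1) X (e (1, d)))
        (polarSideInfo X Y (e (1, d)))
        = varentropy μ (polarTransform n Xm d) (polarSideInfo Xm Ym d) := by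
      intro d
      rw [polarTransform_succ_one]
      refine varentropy_congr_comap (measurable_polarTransform hXm d)
        (measurable_polarSideInfo (fun j _ => hU j) hY)
        (measurable_polarSideInfo (fun j _ => measurable_polarTransform hXm j) hYm) ?_ ?_
      · have hr := fun c => measurable_comap_polarSideInfo_right (X := Xm) (Y := Ym) d c
        refine measurable_polarSideInfo (fun j hj => ?_) fun j => ?_
        · obtain ⟨⟨a, c⟩, rfl⟩ := e.surjective j
          rcases kroneckerIndexEquiv_lt_iff.1 hj with h | ⟨rfl, hc⟩
          · obtain rfl : a = 0 := by omega
            rw [polarTransform_succ_zero]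
            -- Lower-half outputs are functions of the sums `Xp`, which `Ym` contains.
            exact measurable_polarTransform (fun c => measurable_fst.comp (hr c)) c
          · rw [polarTransform_succ_one]
            exact measurable_comap_polarSideInfo_transform hc
        · obtain ⟨⟨a, c⟩, rfl⟩ := e.surjective j
          revert a
          exact Fin.forall_fin_two.2 ⟨(measurable_fst.comp measurable_snd).comp (hr c),
            (measurable_snd.comp measurable_snd).comp (hr c)⟩
      · refine measurable_polarSideInfo (fun c hc => ?_) fun c => ?_
        · rw [← polarTransform_succ_one]
          exact measurable_comap_polarSideInfo_transform
            (kroneckerIndexEquiv_lt_iff.2 (Or.inr ⟨rfl, hc⟩))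
        · refine Measurable.prodMk ?_ ((measurable_comap_polarSideInfo_right _ _).prodMk
            (measurable_comap_polarSideInfo_right _ _))
          -- Conversely, `Xp` is recovered by transforming the lower-half outputs once more; all of
          -- them lie in the past of an upper-half index.
          rw [← polarTransform_polarTransform Xp]
          refine measurable_polarTransform (fun c' => ?_) c
          rw [← polarTransform_succ_zero]
          exact measurable_comap_polarSideInfo_transform
            (kroneckerIndexEquiv_lt_iff.2 (Or.inl zero_lt_one))
    have hstep : ∀ c, varentropy μ (Xp c) (Yp c) + varentropy μ (Xm c) (Ym c) ≤
        varentropy μ (X (e (0, c))) (Y (e (0, c))) + varentropy μ (X (e (1, c))) (Y (e (1, c))) :=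
      fun c => varentropy_add_le (hX _) (hX _) (hY _) (hY _)
        (hindep.indepFun (e.injective.ne (by simp)))
    rw [sum_kroneckerIndexEquiv, sum_kroneckerIndexEquiv]
    calc _ = ∑ d, varentropy μ (polarTransform n Xp d) (polarSideInfo Xp Yp d)
          + ∑ d, varentropy μ (polarTransform n Xm d) (polarSideInfo Xm Ym d) :=
          congrArg₂ _ (Finset.sum_congr rfl fun d _ => hlow d)
            (Finset.sum_congr rfl fun d _ => hhigh d)
      _ ≤ ∑ c, varentropy μ (Xp c) (Yp c) + ∑ c, varentropy μ (Xm c) (Ym c) :=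
          add_le_add (ih Xp Yp hXp hYp hip) (ih Xm Ym hXm hYm him)
      _ ≤ _ := by
          rw [← Finset.sum_add_distrib, ← Finset.sum_add_distrib]
          exact Finset.sum_le_sum fun c _ => hstep c

theorem theorem2 (n : ℕ) (hn : 1 ≤ n) {Ω : Type*} [MeasurableSpace Ω]
    (μ : Measure Ω) [IsProbabilityMeasure μ]
    {S : Fin (2 ^ n) → Type*} [∀ i, MeasurableSpace (S i)]
    (X : Fin (2 ^ n) → Ω → ZMod 2) (Y : (i : Fin (2 ^ n)) → Ω → S i)
    (hX : ∀ i, Measurable (X i)) (hY : ∀ i, Measurable (Y i))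
    (hindep : iIndepFun (fun i ω => (X i ω, Y i ω)) μ) :
    (∀ i, MemLp (condEntropyRV μ (X i) (Y i)) 2 μ) ∧
    (∀ i, MemLp (condEntropyRV μ (polarTransform n X i) (polarSideInfo X Y i)) 2 μ) ∧
    ∑ i, varentropy μ (polarTransform n X i) (polarSideInfo X Y i) ≤
      ∑ i, varentropy μ (X i) (Y i) :=
  ⟨fun i => memLp_condEntropyRV (hX i) (hY i),
    fun i => memLp_condEntropyRV (measurable_polarTransform hX i)
      (measurable_polarSideInfo (fun j _ => measurable_polarTransform hX j) hY),
    sum_varentropy_polarTransform_le n μ X Y hX hY hindep⟩
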